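/- Let $1<p<\infty$ and let $N^p$ be the Bachelis space of all complex sequences $a=(a_n)_{n\ge 0}$ for which the series $\sum_{n\ge 0} a_n z^n$ converges unconditionally in the Hardy space $H^p$ (equivalently, in $L^p$ of the unit circle with normalized Haar measure), with the norm $$\|a\|_{N^p}:=\sup\Big\{\Big\|\sum_{n\ge 0} b_n z^n\Big\|_{L^p} \;:\; b=(b_n)_{n\ge0}\in\mathbb{C}^{\mathbb{N}_0},\ |b_n|\le |a_n| \text{ for all } n\ge 0\Big\}.$$ For $0\le t<1$ let $C_t$ be the generalized Cesàro operator $$C_t x:=\left(\frac{t^n x_0+t^{n-1}x_1+\dots+x_n}{n+1}\right)_{n\ge 0},\qquad x=(x_n)_{n\ge0}\in\mathbb{C}^{\mathbb{N}_0},$$ (with $0^0=1$), and let $\Lambda:=\{\tfrac1{n+1}: n\in\mathbb{N}_0\}$ and $\Lambda_0:=\Lambda\cup\{0\}$. Then $C_t$ maps $N^p$ into $N^p$ and defines a bounded linear operator there, with operator norm $$\|C_t\|_{N^p\to N^p}\le \frac{1}{1-t}.$$ Moreover, $C_t$ is compact on $N^p$, its point spectrum (the set of $\lambda\in\mathbb{C}$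 for which $\lambda I-C_t$ is not injective on $N^p$) is $\sigma_{pt}(C_t;N^p)=\Lambda$, and its spectrum is $\sigma(C_t;N^p)=\Lambda_0$. In addition, $C_t$ is power bounded on $N^p$ (that is, $\sup_{n\ge1}\|C_t^n\|<\infty$) and uniformly mean ergodic (that is, the averages $\frac1n\sum_{m=1}^n C_t^m$ converge in operator norm as $n\to\infty$), but it is not supercyclic (that is, there is no $x\in N^p$ for which $\{\lambda C_t^n x:\lambda\in\mathbb{C},\ n\ge0\}$ is dense in $N^p$). -/

import Mathlib

open scoped ENNReal

noncomputable section

namespace Bachelis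

/-! ### Operator-theoretic notions on a normed space -/

section Operators

variable {X : Type*} [NormedAddCommGroup X] [NormedSpace ℂ X]

/-- The point spectrum: all `z` for which `z I - T` is not injective. -/
def pointSpectrum (T : X →L[ℂ] X) : Set ℂ :=
  {z : ℂ | ¬ Function.Injective (z • ContinuousLinearMap.id ℂ X - T)}

/-- `T` is power bounded: the operator norms of its powers are bounded. -/
def PowerBounded (T : X →L[ℂ] X) : Prop :=
  ∃ M : ℝ, ∀ n : ℕ, ‖T ^ n‖ ≤ M

/-- The averages `(1 / n) (T + T ^ 2 + ... + T ^ n)`, meaningful for `n ≥ 1`. -/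
def ergodicMean (T : X →L[ℂ] X) (n : ℕ) : X →L[ℂ] X :=
  (n : ℂ)⁻¹ • ∑ m ∈ Finset.Icc 1 n, T ^ m

/-- `T` is uniformly mean ergodic: its averages converge in the operator norm. -/
def UniformlyMeanErgodic (T : X →L[ℂ] X) : Prop :=
  ∃ P : X →L[ℂ] X, Filter.Tendsto (ergodicMean T) Filter.atTop (nhds P)

/-- `T` is supercyclic: some projective orbit is dense. -/
def Supercyclic (T : X →L[ℂ] X) : Prop :=
  ∃ x : X, Dense {y : X | ∃ (c : ℂ) (n : ℕ), y = c • (T ^ n) x}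

end Operators

/-! ### The generalized Cesàro operators on the space of all complex sequences -/

/-- `(C_t x)_n = (t ^ n x_0 + t ^ (n - 1) x_1 + ... + x_n) / (n + 1)`, with `0 ^ 0 = 1`. -/
def cesaro (t : ℝ) (x : ℕ → ℂ) (n : ℕ) : ℂ :=
  (∑ k ∈ Finset.range (n + 1), (t : ℂ) ^ (n - k) * x k) / ((n : ℂ) + 1)

/-! ### Bounded multipliers of unconditionally convergent series -/

section Multipliers

variable {E : Type*} [NormedAddCommGroup E] [NormedSpace ℂ E]

theorem norm_sum_smul_le {x : ℕ → E} {s : Finset ℕ} {K : ℝ}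
    (hK : ∀ t ⊆ s, ‖∑ i ∈ t, x i‖ ≤ K) {c : ℕ → ℂ} (hc : ∀ i, ‖c i‖ ≤ 1) :
    ‖∑ i ∈ s, c i • x i‖ ≤ 4 * K := by
  obtain ⟨g, hg, hgx⟩ := exists_dual_vector'' ℂ (∑ i ∈ s, c i • x i)
  have hgK : ∀ t ⊆ s, ‖∑ i ∈ t, g (x i)‖ ≤ K := by
    intro t ht
    rw [← map_sum]
    calc ‖g (∑ i ∈ t, x i)‖ ≤ ‖g‖ * ‖∑ i ∈ t, x i‖ := g.le_opNorm _
      _ ≤ 1 * K := mul_le_mul hg (hK t ht) (norm_nonneg _) zero_le_one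
      _ = K := one_mul K
  have key : ∀ r : ℂ → ℝ, (∀ z, |r z| ≤ ‖z‖) →
      (∀ t : Finset ℕ, r (∑ i ∈ t, g (x i)) = ∑ i ∈ t, r (g (x i))) →
      ∑ i ∈ s, |r (g (x i))| ≤ 2 * K := by
    intro r hr hadd
    rw [← Finset.sum_filter_add_sum_filter_not s (fun i => 0 ≤ r (g (x i)))]
    have h1 : ∑ i ∈ s.filter (fun i => 0 ≤ r (g (x i))), |r (g (x i))| ≤ K := by
      rw [Finset.sum_congr rfl (fun i hi => abs_of_nonneg (Finset.mem_filter.1 hi).2), ← hadd]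
      exact (le_abs_self _).trans ((hr _).trans (hgK _ (Finset.filter_subset _ _)))
    have h2 : ∑ i ∈ s.filter (fun i => ¬ 0 ≤ r (g (x i))), |r (g (x i))| ≤ K := by
      rw [Finset.sum_congr rfl
        (fun i hi => abs_of_neg (not_le.1 (Finset.mem_filter.1 hi).2)),
        Finset.sum_neg_distrib, ← hadd]
      exact (neg_le_abs _).trans ((hr _).trans (hgK _ (Finset.filter_subset _ _)))
    linarith
  have hre := key Complex.re Complex.abs_re_le_norm (fun t => by simp)
  have him := key Complex.im Complex.abs_im_le_norm (fun t => by simp)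
  have hnorm : ‖∑ i ∈ s, c i • x i‖ = ‖g (∑ i ∈ s, c i • x i)‖ := by
    rw [hgx]; simp
  rw [hnorm, map_sum]
  calc ‖∑ i ∈ s, g (c i • x i)‖ ≤ ∑ i ∈ s, ‖g (c i • x i)‖ := norm_sum_le _ _
    _ ≤ ∑ i ∈ s, (|(g (x i)).re| + |(g (x i)).im|) := by
        refine Finset.sum_le_sum fun i _ => ?_
        rw [map_smul, norm_smul]
        calc ‖c i‖ * ‖g (x i)‖ ≤ 1 * ‖g (x i)‖ :=
              mul_le_mul_of_nonneg_right (hc i) (norm_nonneg _)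
          _ = ‖g (x i)‖ := one_mul _
          _ ≤ _ := Complex.norm_le_abs_re_add_abs_im _
    _ ≤ 4 * K := by rw [Finset.sum_add_distrib]; linarith

variable [CompleteSpace E]

theorem exists_multiplier {a b : ℕ → ℂ} (h : ∀ n, ‖b n‖ ≤ ‖a n‖) :
    ∃ c : ℕ → ℂ, (∀ n, ‖c n‖ ≤ 1) ∧ ∀ n, b n = c n * a n := by
  refine ⟨fun n => b n / a n, fun n => ?_, fun n => ?_⟩
  · rw [norm_div]
    exact div_le_one_of_le₀ (h n) (norm_nonneg _)
  · by_cases ha : a n = 0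
    · have := h n
      simp only [ha, norm_zero, norm_le_zero_iff] at this
      simp [this, ha]
    · field_simp

theorem summable_of_le {e : ℕ → E} {a b : ℕ → ℂ} (ha : Summable fun n => a n • e n)
    (h : ∀ n, ‖b n‖ ≤ ‖a n‖) : Summable fun n => b n • e n := by
  obtain ⟨c, hc, hb⟩ := exists_multiplier h
  rw [summable_iff_vanishing_norm] at ha ⊢
  intro ε hε
  obtain ⟨s, hs⟩ := ha (ε / 8) (by positivity)
  refine ⟨s, fun t ht => ?_⟩
  have := norm_sum_smul_le (s := t) (K := ε / 8) (x := fun n => a n • e n)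
    (fun u hu => (hs u (ht.mono_left hu)).le) hc
  simp only [hb, mul_smul]
  linarith

theorem exists_bound {e : ℕ → E} {a : ℕ → ℂ} (ha : Summable fun n => a n • e n) :
    ∃ K : ℝ, ∀ b : ℕ → ℂ, (∀ n, ‖b n‖ ≤ ‖a n‖) → ‖∑' n, b n • e n‖ ≤ K := by
  obtain ⟨s, hs⟩ := summable_iff_vanishing_norm.1 ha 1 one_pos
  set K : ℝ := ∑ i ∈ s, ‖a i • e i‖ + 1
  have hK : ∀ t : Finset ℕ, ‖∑ i ∈ t, a i • e i‖ ≤ K := by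
    intro t
    rw [← Finset.sum_filter_add_sum_filter_not t (fun i => i ∈ s)]
    refine (norm_add_le _ _).trans (add_le_add ?_ (hs _ ?_).le)
    · refine (norm_sum_le _ _).trans
        (Finset.sum_le_sum_of_subset_of_nonneg ?_ fun _ _ _ => norm_nonneg _)
      intro i hi
      exact (Finset.mem_filter.1 hi).2
    · rw [Finset.disjoint_left]
      intro i hi
      exact (Finset.mem_filter.1 hi).2
  refine ⟨4 * K, fun b hb => ?_⟩
  obtain ⟨c, hc, hbc⟩ := exists_multiplier hb
  refine le_of_tendsto (summable_of_le ha hb).hasSum.norm (Filter.Eventually.of_forall ?_)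
  intro t
  simp only [hbc, mul_smul]
  exact norm_sum_smul_le (fun u _ => hK u) hc

end Multipliers

/-! ### The Bachelis spaces -/

section Space

variable (p : ℝ≥0∞) [Fact (1 ≤ p)]

/-- The monomial `z ^ n` as an element of `L ^ p` of the unit circle, which is parametrized by
`ℝ / ℤ` with its Haar probability measure. -/
def monomial (n : ℕ) : MeasureTheory.Lp ℂ p (AddCircle.haarAddCircle (T := (1 : ℝ))) :=
  fourierLp p (n : ℤ)

/-- The sequences `a` for which the Taylor series `∑ a_n z ^ n` converges unconditionally in
`L ^ p` of the circle, equivalently in the Hardy space `H ^ p`. -/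
def bachelisSubmodule : Submodule ℂ (ℕ → ℂ) where
  carrier := {a | Summable fun n => a n • monomial p n}
  zero_mem' := by simp [summable_zero]
  add_mem' {a b} ha hb := by
    simpa only [Set.mem_ofPred_eq, Pi.add_apply, add_smul] using Summable.add ha hb
  smul_mem' c a ha := by
    simpa only [Set.mem_ofPred_eq, Pi.smul_apply, smul_eq_mul, mul_smul] using
      Summable.const_smul c ha

/-- The Bachelis space `N ^ p`, as a type of its own: it carries the norm below and not the
topology of coordinatewise convergence. -/
def BachelisSpace : Type := ↥(bachelisSubmodule p)

instance : AddCommGroup (BachelisSpace p) := inferInstanceAs (AddCommGroup (bachelisSubmodule p))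

instance : Module ℂ (BachelisSpace p) := inferInstanceAs (Module ℂ (bachelisSubmodule p))

instance : CoeFun (BachelisSpace p) (fun _ => ℕ → ℂ) := ⟨Subtype.val⟩

/-- `‖a‖` is the supremum of the `L ^ p` norms of all `∑ b_n z ^ n` with `|b_n| ≤ |a_n|`. -/
instance : Norm (BachelisSpace p) :=
  ⟨fun a => ⨆ b : {b : ℕ → ℂ // ∀ n, ‖b n‖ ≤ ‖a n‖}, ‖∑' n, b.1 n • monomial p n‖⟩

variable {p}

theorem norm_def (a : BachelisSpace p) :
    ‖a‖ = ⨆ b : {b : ℕ → ℂ // ∀ n, ‖b n‖ ≤ ‖a n‖}, ‖∑' n, b.1 n • monomial p n‖ := rfl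

theorem le_norm (a : BachelisSpace p) {b : ℕ → ℂ} (hb : ∀ n, ‖b n‖ ≤ ‖a n‖) :
    ‖∑' n, b n • monomial p n‖ ≤ ‖a‖ := by
  obtain ⟨K, hK⟩ := exists_bound a.2
  rw [norm_def]
  refine le_ciSup (f := fun b : {b : ℕ → ℂ // ∀ n, ‖b n‖ ≤ ‖a n‖} =>
    ‖∑' n, b.1 n • monomial p n‖) ⟨K, ?_⟩ ⟨b, hb⟩
  rintro _ ⟨b', rfl⟩
  exact hK b'.1 b'.2

theorem norm_le (a : BachelisSpace p) {K : ℝ}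
    (hK : ∀ b : ℕ → ℂ, (∀ n, ‖b n‖ ≤ ‖a n‖) → ‖∑' n, b n • monomial p n‖ ≤ K) : ‖a‖ ≤ K := by
  rw [norm_def]
  have : Nonempty {b : ℕ → ℂ // ∀ n, ‖b n‖ ≤ ‖a n‖} := ⟨⟨a, fun _ => le_rfl⟩⟩
  exact ciSup_le fun b => hK b.1 b.2

theorem monomial_ne_zero (n : ℕ) : monomial p n ≠ 0 := by
  intro h
  have h0 : (fourier (n : ℤ) : C(AddCircle (1 : ℝ), ℂ)) = 0 :=
    ContinuousMap.toLp_injective (p := p) (𝕜 := ℂ)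
      (AddCircle.haarAddCircle (T := (1 : ℝ))) (h.trans (map_zero _).symm)
  have := fourier_norm (T := (1 : ℝ)) (n : ℤ)
  rw [h0, norm_zero] at this
  exact zero_ne_one this

theorem norm_nonneg' (a : BachelisSpace p) : 0 ≤ ‖a‖ :=
  (norm_nonneg (∑' n, a n • monomial p n)).trans (le_norm a fun _ => le_rfl)

theorem norm_smul_le' (c : ℂ) (a : BachelisSpace p) : ‖c • a‖ ≤ ‖c‖ * ‖a‖ := by
  refine norm_le _ fun b hb => ?_
  have hb' : ∀ n, ‖b n‖ ≤ ‖c‖ * ‖a n‖ := fun n => by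
    simpa only [norm_mul] using show ‖b n‖ ≤ ‖c * a n‖ from hb n
  by_cases hc : c = 0
  · have : ∀ n, b n = 0 := fun n => by simpa [hc] using hb' n
    simp [this, hc]
  · have hc0 : 0 < ‖c‖ := norm_pos_iff.2 hc
    have h1 : ∀ n, ‖c⁻¹ * b n‖ ≤ ‖a n‖ := fun n => by
      rw [norm_mul, norm_inv, inv_mul_le_iff₀ hc0]
      exact hb' n
    have h2 : ∑' n, b n • monomial p n = c • ∑' n, (c⁻¹ * b n) • monomial p n := by
      rw [← (summable_of_le a.2 h1).tsum_const_smul c]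
      refine tsum_congr fun n => ?_
      rw [smul_smul, mul_inv_cancel_left₀ hc]
    rw [h2, norm_smul]
    exact mul_le_mul_of_nonneg_left (le_norm a h1) hc0.le

theorem norm_core : NormedSpace.Core ℂ (BachelisSpace p) where
  norm_nonneg := norm_nonneg'
  norm_smul c a := by
    refine le_antisymm (norm_smul_le' c a) ?_
    by_cases hc : c = 0
    · subst hc
      rw [norm_zero, zero_mul]
      exact norm_nonneg' _
    · have h := norm_smul_le' c⁻¹ (c • a)
      rwa [inv_smul_smul₀ hc, norm_inv, ← div_eq_inv_mul, le_div_iff₀' (norm_pos_iff.2 hc)] at h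
  norm_triangle a a' := by
    refine norm_le _ fun b hb => ?_
    have hb' : ∀ n, ‖b n‖ ≤ ‖a n‖ + ‖a' n‖ := fun n =>
      (show ‖b n‖ ≤ ‖a n + a' n‖ from hb n).trans (norm_add_le _ _)
    obtain ⟨c, hc, hbc⟩ := exists_multiplier
      (a := fun n => ((‖a n‖ + ‖a' n‖ : ℝ) : ℂ)) (b := b) (fun n => by
        rw [Complex.norm_of_nonneg (by positivity)]; exact hb' n)
    have h1 : ∀ n, ‖c n * (‖a n‖ : ℂ)‖ ≤ ‖a n‖ := fun n => by
      rw [norm_mul, Complex.norm_of_nonneg (norm_nonneg _)]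
      exact mul_le_of_le_one_left (norm_nonneg _) (hc n)
    have h2 : ∀ n, ‖c n * (‖a' n‖ : ℂ)‖ ≤ ‖a' n‖ := fun n => by
      rw [norm_mul, Complex.norm_of_nonneg (norm_nonneg _)]
      exact mul_le_of_le_one_left (norm_nonneg _) (hc n)
    have h3 : ∑' n, b n • monomial p n =
        ∑' n, (c n * (‖a n‖ : ℂ)) • monomial p n + ∑' n, (c n * (‖a' n‖ : ℂ)) • monomial p n := by
      rw [← (summable_of_le a.2 h1).tsum_add (summable_of_le a'.2 h2)]
      refine tsum_congr fun n => ?_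
      rw [hbc n, ← add_smul, Complex.ofReal_add, mul_add]
    rw [h3]
    exact (norm_add_le _ _).trans (add_le_add (le_norm a h1) (le_norm a' h2))
  norm_eq_zero_iff a := by
    constructor
    · intro h
      refine Subtype.ext (funext fun n => ?_)
      have hb : ∀ m, ‖(Pi.single n (a n) : ℕ → ℂ) m‖ ≤ ‖a m‖ := fun m => by
        by_cases hm : m = n
        · subst hm; simp
        · simp [Pi.single_eq_of_ne hm]
      have h1 := le_norm a hb
      rw [h, tsum_eq_single n (fun m hm => by simp [Pi.single_eq_of_ne hm])] at h1
      have h2 : a n = 0 := by simpa [monomial_ne_zero] using h1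
      exact h2
    · rintro rfl
      refine le_antisymm (norm_le _ fun b hb => ?_) (norm_nonneg' _)
      have : ∀ n, b n = 0 := fun n =>
        norm_le_zero_iff.1 ((show ‖b n‖ ≤ ‖(0 : ℂ)‖ from hb n).trans norm_zero.le)
      simp [this]

instance : NormedAddCommGroup (BachelisSpace p) := NormedAddCommGroup.ofCore norm_core

instance : NormedSpace ℂ (BachelisSpace p) := NormedSpace.ofCore norm_core

end Space

end Bachelis

end

noncomputable section

open Filter Topology

namespace Bachelis

variable {p : ENNReal} [Fact (1 ≤ p)]

namespace BachelisSpace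

@[ext]
theorem ext {a b : BachelisSpace p} (h : ∀ n, a n = b n) : a = b :=
  Subtype.ext (funext h)

@[simp] theorem coeFn_add_apply (a b : BachelisSpace p) (n : ℕ) : (a + b) n = a n + b n := rfl

@[simp] theorem coeFn_sub_apply (a b : BachelisSpace p) (n : ℕ) : (a - b) n = a n - b n := rfl

@[simp] theorem coeFn_zero_apply (n : ℕ) : (0 : BachelisSpace p) n = 0 := rfl

@[simp] theorem coeFn_smul_apply (c : ℂ) (a : BachelisSpace p) (n : ℕ) : (c • a) n = c * a n := rfl

theorem summable (a : BachelisSpace p) : Summable fun n => a n • monomial p n := a.2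

/-- The element of `N ^ p` given by a sequence whose Taylor series converges unconditionally. -/
def mk (a : ℕ → ℂ) (ha : Summable fun n => a n • monomial p n) : BachelisSpace p := ⟨a, ha⟩

@[simp] theorem mk_apply (a : ℕ → ℂ) (ha : Summable fun n => a n • monomial p n) (n : ℕ) :
    mk a ha n = a n := rfl

theorem norm_sum_le_norm (a : BachelisSpace p) {b : ℕ → ℂ} (hb : ∀ n, ‖b n‖ ≤ ‖a n‖)
    (s : Finset ℕ) : ‖∑ n ∈ s, b n • monomial p n‖ ≤ ‖a‖ := by
  have h := le_norm a (b := fun n => if n ∈ s then b n else 0) (fun n => by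
    by_cases hn : n ∈ s
    · simpa [hn] using hb n
    · simp [hn])
  rw [tsum_eq_sum (s := s) (fun n hn => by simp [hn])] at h
  rwa [Finset.sum_congr rfl (fun n hn => by rw [if_pos hn])] at h

theorem norm_le_of_sum_le (a : BachelisSpace p) {K : ℝ}
    (hK : ∀ b : ℕ → ℂ, (∀ n, ‖b n‖ ≤ ‖a n‖) →
      ∀ s : Finset ℕ, ‖∑ n ∈ s, b n • monomial p n‖ ≤ K) : ‖a‖ ≤ K :=
  norm_le a fun b hb =>
    le_of_tendsto (summable_of_le a.2 hb).hasSum.norm (Eventually.of_forall (hK b hb))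

theorem norm_mono {a b : BachelisSpace p} (h : ∀ n, ‖a n‖ ≤ ‖b n‖) : ‖a‖ ≤ ‖b‖ :=
  norm_le a fun _ hc => le_norm b fun n => (hc n).trans (h n)

theorem norm_apply_mul_le (a : BachelisSpace p) (n : ℕ) : ‖a n‖ * ‖monomial p n‖ ≤ ‖a‖ := by
  simpa [norm_smul] using norm_sum_le_norm a (b := a) (fun _ => le_rfl) {n}

/-- The `n`-th coordinate as a continuous functional. -/
def coord (n : ℕ) : BachelisSpace p →L[ℂ] ℂ :=
  LinearMap.mkContinuous
    { toFun := fun a => a n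
      map_add' := fun _ _ => rfl
      map_smul' := fun _ _ => rfl } ‖monomial p n‖⁻¹ fun a => by
    rw [inv_mul_eq_div, le_div_iff₀ (norm_pos_iff.2 (monomial_ne_zero n))]
    exact norm_apply_mul_le a n

@[simp] theorem coord_apply (n : ℕ) (a : BachelisSpace p) : coord n a = a n := rfl

/-- The `n`-th unit sequence. -/
def single (n : ℕ) : BachelisSpace p :=
  mk (Pi.single n 1) (summable_of_ne_finset_zero (s := {n}) fun m hm => by
    simp [Pi.single_eq_of_ne (by simpa using hm : m ≠ n)])

theorem single_apply (n m : ℕ) : (single n : BachelisSpace p) m = if m = n then 1 else 0 := by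
  simp [single, Pi.single_apply]

instance : Nontrivial (BachelisSpace p) :=
  ⟨single 0, 0, fun h => by simpa [single_apply] using congrArg (coord 0) h⟩

instance : CompleteSpace (BachelisSpace p) := by
  refine Metric.complete_of_cauchySeq_tendsto fun u hu => ?_
  have hc : ∀ n, ∃ z, Tendsto (fun k => u k n) atTop (𝓝 z) := fun n =>
    cauchySeq_tendsto_of_complete (hu.map (coord n).uniformContinuous)
  choose a ha using hc
  have key : ∀ ε > 0, ∃ N, ∀ k ≥ N, ∀ b : ℕ → ℂ, (∀ n, ‖b n‖ ≤ ‖u k n - a n‖) →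
      ∀ s : Finset ℕ, ‖∑ n ∈ s, b n • monomial p n‖ ≤ ε := by
    intro ε hε
    obtain ⟨N, hN⟩ := Metric.cauchySeq_iff.1 hu ε hε
    refine ⟨N, fun k hk b hb s => ?_⟩
    obtain ⟨c, hc, hbc⟩ := exists_multiplier hb
    have hlim : Tendsto (fun j => ∑ n ∈ s, (c n * (u k n - u j n)) • monomial p n) atTop
        (𝓝 (∑ n ∈ s, b n • monomial p n)) := by
      refine tendsto_finsetSum _ fun n _ => ?_
      rw [hbc n]
      exact ((tendsto_const_nhds.sub (ha n)).const_mul (c n)).smul_const _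
    refine le_of_tendsto hlim.norm ?_
    filter_upwards [eventually_ge_atTop N] with j hj
    refine (norm_sum_le_norm (u k - u j) (fun n => ?_) s).trans ?_
    · rw [norm_mul]
      exact mul_le_of_le_one_left (norm_nonneg _) (hc n)
    · rw [← dist_eq_norm]
      exact (hN k hk j hj).le
  have hsum : Summable fun n => a n • monomial p n := by
    rw [summable_iff_vanishing_norm]
    intro ε hε
    obtain ⟨N, hN⟩ := key (ε / 4) (by positivity)
    obtain ⟨s, hs⟩ := summable_iff_vanishing_norm.1 (u N).summable (ε / 4) (by positivity)
    refine ⟨s, fun t ht => ?_⟩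
    have h1 := hN N le_rfl (fun n => u N n - a n) (fun _ => le_rfl) t
    have h2 := hs t ht
    have h3 : ∑ n ∈ t, a n • monomial p n =
        ∑ n ∈ t, u N n • monomial p n - ∑ n ∈ t, (u N n - a n) • monomial p n := by
      simp [sub_smul]
    rw [h3]
    refine (norm_sub_le _ _).trans_lt ?_
    linarith
  refine ⟨mk a hsum, Metric.tendsto_atTop.2 fun ε hε => ?_⟩
  obtain ⟨N, hN⟩ := key (ε / 2) (by positivity)
  refine ⟨N, fun k hk => ?_⟩
  rw [dist_eq_norm]
  refine (norm_le_of_sum_le _ (hN k hk)).trans_lt ?_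
  linarith

/-- The coordinatewise multiplication by a bounded sequence. -/
def diagonal (c : ℕ → ℂ) (K : ℝ) (hc : ∀ n, ‖c n‖ ≤ K) : BachelisSpace p →L[ℂ] BachelisSpace p :=
  have hle : ∀ (a : BachelisSpace p) (n : ℕ), ‖c n * a n‖ ≤ ‖((K : ℂ) • a) n‖ := fun a n => by
    rw [coeFn_smul_apply, norm_mul, norm_mul, Complex.norm_real]
    exact mul_le_mul_of_nonneg_right ((hc n).trans (le_abs_self K)) (norm_nonneg _)
  LinearMap.mkContinuous
    { toFun := fun a => mk (fun n => c n * a n) (summable_of_le ((K : ℂ) • a).2 (hle a))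
      map_add' := fun a b => by ext n; simp [mul_add]
      map_smul' := fun z a => by ext n; simp [mul_left_comm] } K fun a => by
    refine (norm_mono (b := (K : ℂ) • a) (hle a)).trans ?_
    rw [norm_smul, Complex.norm_of_nonneg ((norm_nonneg _).trans (hc 0))]

@[simp] theorem diagonal_apply (c : ℕ → ℂ) (K : ℝ) (hc : ∀ n, ‖c n‖ ≤ K) (a : BachelisSpace p)
    (n : ℕ) : diagonal c K hc a n = c n * a n := rfl

theorem norm_diagonal_le (c : ℕ → ℂ) (K : ℝ) (hc : ∀ n, ‖c n‖ ≤ K) :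
    ‖(diagonal c K hc : BachelisSpace p →L[ℂ] BachelisSpace p)‖ ≤ K := by
  have hK : 0 ≤ K := (norm_nonneg _).trans (hc 0)
  refine ContinuousLinearMap.opNorm_le_bound _ hK fun a => ?_
  refine (norm_mono (b := (K : ℂ) • a) fun n => ?_).trans ?_
  · rw [diagonal_apply, coeFn_smul_apply, norm_mul, norm_mul, Complex.norm_of_nonneg hK]
    exact mul_le_mul_of_nonneg_right (hc n) (norm_nonneg _)
  · rw [norm_smul, Complex.norm_of_nonneg hK]

/-- A diagonal operator whose entries tend to zero is compact. -/
theorem isCompactOperator_diagonal (c : ℕ → ℂ) (K : ℝ) (hc : ∀ n, ‖c n‖ ≤ K)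
    (h0 : Tendsto c atTop (𝓝 0)) :
    IsCompactOperator (diagonal c K hc : BachelisSpace p →L[ℂ] BachelisSpace p) := by
  let F : ℕ → BachelisSpace p →L[ℂ] BachelisSpace p := fun N =>
    ∑ n ∈ Finset.range N, (coord n).smulRight (c n • single n)
  have hF : ∀ N a m, F N a m = if m < N then c m * a m else 0 := by
    intro N a m
    have : F N a m = coord m (F N a) := rfl
    rw [this]
    simp only [F, sum_apply, map_sum, ContinuousLinearMap.smulRight_apply,
      coord_apply, coeFn_smul_apply, single_apply, mul_ite, mul_one, mul_zero, Finset.sum_ite_eq,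
      Finset.mem_range]
    exact if_congr Iff.rfl (mul_comm _ _) rfl
  have hFc : ∀ N, IsCompactOperator (F N) := fun N => by
    refine Submodule.sum_mem (compactOperator (RingHom.id ℂ) (BachelisSpace p) (BachelisSpace p))
      fun n _ => ?_
    exact (isCompactOperator_of_locallyCompactSpace_dom
      (coord n : BachelisSpace p →L[ℂ] ℂ)).clm_comp
      ((ContinuousLinearMap.id ℂ ℂ).smulRight (c n • single n : BachelisSpace p))
  refine isCompactOperator_of_tendsto (l := atTop) (F := F) ?_ (Eventually.of_forall hFc)
  refine Metric.tendsto_atTop.2 fun ε hε => ?_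
  obtain ⟨N, hN⟩ := Metric.tendsto_atTop.1 h0 (ε / 2) (by positivity)
  refine ⟨N, fun k hk => ?_⟩
  rw [dist_eq_norm]
  refine lt_of_le_of_lt (ContinuousLinearMap.opNorm_le_bound _ (half_pos hε).le fun a => ?_)
    (half_lt_self hε)
  have hle : ‖(F k - (diagonal c K hc : BachelisSpace p →L[ℂ] BachelisSpace p)) a‖ ≤ ‖((ε / 2 : ℝ) : ℂ) • a‖ := by
    refine norm_mono fun n => ?_
    rw [sub_apply, coeFn_sub_apply, hF, diagonal_apply, coeFn_smul_apply, norm_mul,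
      Complex.norm_of_nonneg (half_pos hε).le]
    split_ifs with hn
    · rw [sub_self, norm_zero]; positivity
    · rw [zero_sub, norm_neg, norm_mul]
      refine mul_le_mul_of_nonneg_right ?_ (norm_nonneg _)
      simpa using (hN n (hk.trans (not_lt.1 hn))).le
  rwa [norm_smul, Complex.norm_of_nonneg (half_pos hε).le] at hle

theorem coeFn_sum_smul_fourierLp (c : ℕ → ℂ) (k : ℕ → ℤ) (s : Finset ℕ) :
    (∑ n ∈ s, c n • fourierLp (T := (1 : ℝ)) p (k n) : MeasureTheory.Lp ℂ p _)
      =ᵐ[AddCircle.haarAddCircle] fun x => ∑ n ∈ s, c n * fourier (k n) x := by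
  have h : (∑ n ∈ s, c n • fourierLp (T := (1 : ℝ)) p (k n)) =
      ContinuousMap.toLp p AddCircle.haarAddCircle ℂ (∑ n ∈ s, c n • fourier (k n)) := by
    simp [map_sum, map_smul]
  rw [h]
  filter_upwards [ContinuousMap.coeFn_toLp (p := p) (𝕜 := ℂ)
    (AddCircle.haarAddCircle (T := (1 : ℝ))) (∑ n ∈ s, c n • fourier (k n))] with x hx
  rw [hx]
  simp [ContinuousMap.sum_apply]

theorem norm_sum_smul_monomial_succ (c : ℕ → ℂ) (s : Finset ℕ) :
    ‖∑ n ∈ s, c n • monomial p (n + 1)‖ = ‖∑ n ∈ s, c n • monomial p n‖ := by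
  have h : ∀ᵐ x ∂AddCircle.haarAddCircle (T := (1 : ℝ)),
      ‖(∑ n ∈ s, c n • monomial p (n + 1)) x‖ = ‖(∑ n ∈ s, c n • monomial p n) x‖ := by
    filter_upwards [coeFn_sum_smul_fourierLp (p := p) c (fun n => ((n + 1 : ℕ) : ℤ)) s,
      coeFn_sum_smul_fourierLp (p := p) c (fun n => (n : ℤ)) s] with x h1 h2
    simp only [monomial]
    rw [h1, h2]
    have : ∑ n ∈ s, c n * fourier ((n + 1 : ℕ) : ℤ) x =
        fourier 1 x * ∑ n ∈ s, c n * fourier (n : ℤ) x := by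
      rw [Finset.mul_sum]
      refine Finset.sum_congr rfl fun n _ => ?_
      rw [Nat.cast_succ, fourier_add]
      ring
    rw [this, norm_mul, show ‖fourier 1 x‖ = 1 from Circle.norm_coe _, one_mul]
  exact le_antisymm (MeasureTheory.Lp.norm_le_norm_of_ae_le (h.mono fun _ hx => hx.le))
    (MeasureTheory.Lp.norm_le_norm_of_ae_le (h.mono fun _ hx => hx.ge))

theorem summable_shift (a : BachelisSpace p) :
    Summable fun n => a n • monomial p (n + 1) := by
  have h := a.summable
  rw [summable_iff_vanishing_norm] at h ⊢
  simpa only [norm_sum_smul_monomial_succ] using h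

/-- The right shift of a sequence. -/
def shiftSeq (a : ℕ → ℂ) : ℕ → ℂ
  | 0 => 0
  | n + 1 => a n

theorem summable_shiftSeq (a : BachelisSpace p) :
    Summable fun n => shiftSeq a n • monomial p n :=
  (summable_nat_add_iff 1).1 a.summable_shift

theorem norm_le_norm_of_shift {a y : BachelisSpace p} (h0 : y 0 = 0) (h1 : ∀ n, y (n + 1) = a n) :
    ‖y‖ ≤ ‖a‖ := by
  refine norm_le y fun b hb => ?_
  have hb0 : b 0 = 0 := by simpa [h0] using hb 0
  have hb1 : ∀ n, ‖b (n + 1)‖ ≤ ‖a n‖ := fun n => by rw [← h1]; exact hb (n + 1)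
  have hs' : Summable fun n => b n • monomial p n := summable_of_le y.summable hb
  have hs : Summable fun n => b (n + 1) • monomial p (n + 1) := (summable_nat_add_iff 1).2 hs'
  rw [hs'.tsum_eq_zero_add, hb0, zero_smul, zero_add]
  refine le_of_tendsto hs.hasSum.norm (Eventually.of_forall fun s => ?_)
  rw [norm_sum_smul_monomial_succ (fun n => b (n + 1))]
  exact norm_sum_le_norm a hb1 s

/-- The right shift, that is, the multiplication by `z`. -/
def shift : BachelisSpace p →L[ℂ] BachelisSpace p :=
  LinearMap.mkContinuous
    { toFun := fun a => mk (shiftSeq a) a.summable_shiftSeq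
      map_add' := fun a b => by ext n; cases n <;> simp [shiftSeq]
      map_smul' := fun z a => by ext n; cases n <;> simp [shiftSeq] } 1 fun a => by
    rw [one_mul]
    exact norm_le_norm_of_shift rfl fun _ => rfl

@[simp] theorem shift_apply_zero (a : BachelisSpace p) : shift a 0 = 0 := rfl

@[simp] theorem shift_apply_succ (a : BachelisSpace p) (n : ℕ) : shift a (n + 1) = a n := rfl

theorem norm_shift_le : ‖(shift : BachelisSpace p →L[ℂ] BachelisSpace p)‖ ≤ 1 := by
  unfold shift
  exact LinearMap.mkContinuous_norm_le _ zero_le_one _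

theorem norm_monomial (n : ℕ) : ‖monomial p n‖ = ‖monomial p 0‖ := by
  induction n with
  | zero => rfl
  | succ n ih => simpa [ih] using norm_sum_smul_monomial_succ (p := p) 1 {n}

end BachelisSpace

theorem tendsto_pow_zero_of_spectralRadius_lt_one {A : Type*} [NormedRing A] [NormedAlgebra ℂ A]
    [CompleteSpace A] {a : A} (h : spectralRadius ℂ a < 1) :
    Tendsto (fun n : ℕ => a ^ n) atTop (𝓝 0) := by
  obtain ⟨r, hr, hr1⟩ := ENNReal.lt_iff_exists_nnreal_btwn.1 h
  have hr1' : r < 1 := by exact_mod_cast hr1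
  rw [tendsto_zero_iff_norm_tendsto_zero]
  refine squeeze_zero' (Eventually.of_forall fun n => norm_nonneg _) ?_
    (tendsto_pow_atTop_nhds_zero_of_lt_one r.coe_nonneg hr1')
  filter_upwards [(spectrum.pow_nnnorm_pow_one_div_tendsto_nhds_spectralRadius a).eventually_lt_const
    hr, eventually_ge_atTop 1] with n hn hn1
  have hn0 : (n : ℝ) ≠ 0 := by positivity
  have h2 := ENNReal.rpow_le_rpow hn.le n.cast_nonneg
  rw [← ENNReal.rpow_mul, one_div_mul_cancel hn0, ENNReal.rpow_one, ENNReal.rpow_natCast] at h2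
  exact_mod_cast h2

section Operators

variable {X : Type*} [NormedAddCommGroup X] [NormedSpace ℂ X]

theorem powerBounded_of_tendsto {T P : X →L[ℂ] X}
    (h : Tendsto (fun n : ℕ => T ^ n) atTop (𝓝 P)) : PowerBounded T := by
  obtain ⟨M, hM⟩ := h.norm.bddAbove_range
  exact ⟨M, fun n => hM ⟨n, rfl⟩⟩

theorem uniformlyMeanErgodic_of_tendsto {T P : X →L[ℂ] X}
    (h : Tendsto (fun n : ℕ => T ^ n) atTop (𝓝 P)) : UniformlyMeanErgodic T := by
  refine ⟨P, ((h.comp (tendsto_add_atTop_nat 1)).cesaro_smul).congr fun n => ?_⟩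
  rw [ergodicMean, ← Complex.coe_smul, Finset.range_eq_Ico, ← Finset.Ico_add_one_right_eq_Icc,
    ← Finset.sum_Ico_add' (fun m => T ^ m) 0 n 1]
  simp

theorem tendsto_pow_of_spectralRadius_sub_lt_one [CompleteSpace X] {T P : X →L[ℂ] X}
    (hTP : T * P = P) (hPT : P * T = P) (hPP : P * P = P) (h : spectralRadius ℂ (T - P) < 1) :
    Tendsto (fun n : ℕ => T ^ n) atTop (𝓝 P) := by
  have hpow : ∀ n : ℕ, T ^ (n + 1) = P + (T - P) ^ (n + 1) := by
    intro n
    induction n with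
    | zero => simp
    | succ n ih =>
      have h1 : (T - P) ^ (n + 1) * P = 0 := by
        rw [pow_succ, mul_assoc, sub_mul, hTP, hPP, sub_self, mul_zero]
      rw [pow_succ, ih, pow_succ (T - P) (n + 1), add_mul, hPT, mul_sub, h1, sub_zero]
  rw [← tendsto_add_atTop_iff_nat 1]
  simp only [hpow]
  simpa using ((tendsto_pow_zero_of_spectralRadius_lt_one h).comp
    (tendsto_add_atTop_nat 1)).const_add P

theorem mem_pointSpectrum_iff {T : X →L[ℂ] X} {z : ℂ} :
    z ∈ pointSpectrum T ↔ ∃ x, x ≠ 0 ∧ T x = z • x := by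
  rw [pointSpectrum, Set.mem_ofPred_eq, injective_iff_map_eq_zero]
  push Not
  refine exists_congr fun x => ?_
  rw [and_comm]
  refine and_congr Iff.rfl ?_
  rw [sub_apply, sub_eq_zero, eq_comm]
  rfl

theorem hasEigenvalue_iff_mem_pointSpectrum {T : X →L[ℂ] X} {z : ℂ} :
    Module.End.HasEigenvalue (T : Module.End ℂ X) z ↔ z ∈ pointSpectrum T := by
  rw [mem_pointSpectrum_iff]
  constructor
  · intro h
    obtain ⟨x, hx⟩ := h.exists_hasEigenvector
    exact ⟨x, hx.2, hx.apply_eq_smul⟩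
  · rintro ⟨x, hx, hTx⟩
    exact Module.End.hasEigenvalue_of_hasEigenvector
      (Module.End.hasEigenvector_iff.2 ⟨Module.End.mem_eigenspace_iff.2 hTx, hx⟩)

end Operators

open BachelisSpace

theorem norm_inv_natCast_add_one_le (n : ℕ) : ‖((n : ℂ) + 1)⁻¹‖ ≤ 1 := by
  rw [norm_inv, ← Nat.cast_succ, Complex.norm_natCast]
  exact inv_le_one_of_one_le₀ (by simp)

theorem tendsto_inv_natCast_add_one : Tendsto (fun n : ℕ => ((n : ℂ) + 1)⁻¹) atTop (𝓝 0) := by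
  simpa using tendsto_one_div_add_atTop_nhds_zero_nat (𝕜 := ℂ)

/-- The generalized Cesàro operator on `N ^ p`, as a diagonal operator composed with a geometric
series of the shift. -/
def cesaroOperator (p : ENNReal) [Fact (1 ≤ p)] (t : ℝ) : BachelisSpace p →L[ℂ] BachelisSpace p :=
  diagonal (fun n => ((n : ℂ) + 1)⁻¹) 1 norm_inv_natCast_add_one_le *
    ∑' k : ℕ, ((t : ℂ) • shift) ^ k

section

variable {t : ℝ}

theorem norm_smul_shift_le (ht0 : 0 ≤ t) :
    ‖(t : ℂ) • (shift : BachelisSpace p →L[ℂ] BachelisSpace p)‖ ≤ t := by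
  rw [norm_smul, Complex.norm_of_nonneg ht0]
  exact mul_le_of_le_one_right ht0 norm_shift_le

theorem geom_shift_apply (ht0 : 0 ≤ t) (ht1 : t < 1) (x : BachelisSpace p) :
    (∑' k : ℕ, ((t : ℂ) • (shift : BachelisSpace p →L[ℂ] BachelisSpace p)) ^ k) x =
      x + (t : ℂ) • shift
        ((∑' k : ℕ, ((t : ℂ) • (shift : BachelisSpace p →L[ℂ] BachelisSpace p)) ^ k) x) := by
  have h := mul_neg_geom_series ((t : ℂ) • (shift : BachelisSpace p →L[ℂ] BachelisSpace p))
    ((norm_smul_shift_le ht0).trans_lt ht1)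
  have h' := DFunLike.congr_fun h x
  rw [sub_mul, one_mul, sub_apply, sub_eq_iff_eq_add] at h'
  exact h'

theorem cesaroOperator_apply_zero (ht0 : 0 ≤ t) (ht1 : t < 1) (x : BachelisSpace p) : cesaroOperator p t x 0 = x 0 := by
  rw [cesaroOperator, mul_apply_eq_comp, diagonal_apply, geom_shift_apply ht0 ht1,
    coeFn_add_apply, coeFn_smul_apply, shift_apply_zero]
  simp

theorem cesaroOperator_apply_succ (ht0 : 0 ≤ t) (ht1 : t < 1) (x : BachelisSpace p) (n : ℕ) :
    ((n : ℂ) + 2) * cesaroOperator p t x (n + 1) =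
      t * (((n : ℂ) + 1) * cesaroOperator p t x n) + x (n + 1) := by
  have h1 : (n : ℂ) + 1 ≠ 0 := by exact_mod_cast n.succ_ne_zero
  have h2 : (n : ℂ) + 2 ≠ 0 := by exact_mod_cast (n + 1).succ_ne_zero
  simp only [cesaroOperator, mul_apply_eq_comp, diagonal_apply]
  rw [mul_inv_cancel_left₀ h1, geom_shift_apply ht0 ht1, coeFn_add_apply, coeFn_smul_apply, shift_apply_succ,
    ← geom_shift_apply ht0 ht1, Nat.cast_succ, add_assoc, one_add_one_eq_two, mul_inv_cancel_left₀ h2, add_comm]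

theorem cesaroOperator_apply (ht0 : 0 ≤ t) (ht1 : t < 1) (x : BachelisSpace p) (n : ℕ) :
    cesaroOperator p t x n = cesaro t x n := by
  rw [cesaro, eq_div_iff (by exact_mod_cast n.succ_ne_zero), mul_comm]
  induction n with
  | zero => simp [cesaroOperator_apply_zero ht0 ht1]
  | succ n ih =>
    rw [Nat.cast_succ, add_assoc, one_add_one_eq_two, cesaroOperator_apply_succ ht0 ht1, ih,
      Finset.sum_range_succ _ (n + 1), Finset.mul_sum]
    congr 1
    · refine Finset.sum_congr rfl fun k hk => ?_
      rw [Nat.succ_sub (Nat.lt_succ_iff.1 (Finset.mem_range.1 hk)), pow_succ]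
      ring
    · simp

theorem norm_cesaroOperator_le (ht0 : 0 ≤ t) (ht1 : t < 1) :
    ‖cesaroOperator p t‖ ≤ 1 / (1 - t) := by
  have hn := norm_smul_shift_le (p := p) ht0
  refine (norm_mul_le _ _).trans ?_
  refine (mul_le_of_le_one_left (norm_nonneg _) (norm_diagonal_le _ _ _)).trans ?_
  have h := tsum_geometric_le_of_norm_lt_one _ (hn.trans_lt ht1)
  rw [norm_one, sub_self, zero_add] at h
  rw [one_div]
  exact h.trans (inv_anti₀ (by linarith) (by linarith))

theorem isCompactOperator_cesaroOperator : IsCompactOperator (cesaroOperator p t) :=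
  (isCompactOperator_diagonal _ 1 norm_inv_natCast_add_one_le
    tendsto_inv_natCast_add_one).comp_clm
    (∑' k : ℕ, ((t : ℂ) • shift) ^ k)

/-- An eigenvector vanishes as soon as it vanishes at the indices that belong to the eigenvalue. -/
theorem eq_zero_of_cesaroOperator_apply_eq_smul (ht0 : 0 ≤ t) (ht1 : t < 1)
    {x : BachelisSpace p} {z : ℂ}
    (hx : cesaroOperator p t x = z • x) (h : ∀ n : ℕ, z = 1 / ((n : ℂ) + 1) → x n = 0) :
    x = 0 := by
  ext n
  rw [coeFn_zero_apply]
  induction n with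
  | zero =>
    have h0 := cesaroOperator_apply_zero ht0 ht1 x
    rw [hx, coeFn_smul_apply] at h0
    by_cases hz : z = 1
    · exact h 0 (by simp [hz])
    · exact by_contra fun hx0 => hz (mul_eq_right₀ hx0 |>.1 h0)
  | succ n ih =>
    have h0 := cesaroOperator_apply_succ ht0 ht1 x n
    rw [hx, coeFn_smul_apply, coeFn_smul_apply, ih, mul_zero, mul_zero, mul_zero, zero_add, ← mul_assoc] at h0
    by_contra hx0
    have h2 : (n : ℂ) + 2 ≠ 0 := by exact_mod_cast (n + 1).succ_ne_zero
    refine hx0 (h (n + 1) ?_)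
    rw [Nat.cast_succ, add_assoc, one_add_one_eq_two, eq_div_iff h2, mul_comm]
    exact (mul_eq_right₀ hx0).1 h0

theorem summable_choose_mul_pow_smul_monomial (ht0 : 0 ≤ t) (ht1 : t < 1) (m : ℕ) :
    Summable fun n => ((n.choose m : ℂ) * (t : ℂ) ^ (n - m)) • monomial p n := by
  rw [← summable_nat_add_iff m]
  have ht : ‖t‖ < 1 := by rwa [Real.norm_of_nonneg ht0]
  refine Summable.of_norm_bounded
    ((summable_choose_mul_geometric_of_norm_lt_one m ht).mul_right ‖monomial p 0‖) fun n => ?_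
  rw [norm_smul, norm_monomial, norm_mul, norm_pow, Complex.norm_of_nonneg ht0,
    Complex.norm_natCast, Nat.add_sub_cancel]

/-- The eigenvector of the Cesàro operator at the eigenvalue `1 / (m + 1)`. -/
def cesaroEigenvector (p : ENNReal) [Fact (1 ≤ p)] (ht0 : 0 ≤ t) (ht1 : t < 1) (m : ℕ) :
    BachelisSpace p :=
  mk (fun n => (n.choose m : ℂ) * (t : ℂ) ^ (n - m))
    (summable_choose_mul_pow_smul_monomial ht0 ht1 m)

theorem cesaroEigenvector_apply (ht0 : 0 ≤ t) (ht1 : t < 1) (m n : ℕ) :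
    cesaroEigenvector p ht0 ht1 m n = (n.choose m : ℂ) * (t : ℂ) ^ (n - m) := rfl

theorem cesaroEigenvector_ne_zero (ht0 : 0 ≤ t) (ht1 : t < 1) (m : ℕ) :
    cesaroEigenvector p ht0 ht1 m ≠ 0 := fun h => by
  simpa [cesaroEigenvector_apply] using congrArg (coord m) h

theorem cesaroEigenvector_succ (ht0 : 0 ≤ t) (ht1 : t < 1) (m n : ℕ) :
    ((n : ℂ) + 1 - m) * cesaroEigenvector p ht0 ht1 m (n + 1) =
      t * (((n : ℂ) + 1) * cesaroEigenvector p ht0 ht1 m n) := by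
  simp only [cesaroEigenvector_apply]
  rcases lt_trichotomy m (n + 1) with h | rfl | h
  · have hmn : m ≤ n := Nat.lt_succ_iff.1 h
    have h1 := congrArg (Nat.cast (R := ℂ)) (Nat.choose_mul_succ_eq n m)
    push_cast [Nat.cast_sub h.le] at h1
    rw [Nat.succ_sub hmn, pow_succ]
    linear_combination -(t : ℂ) ^ (n - m) * t * h1
  · simp
  · simp [Nat.choose_eq_zero_of_lt h, Nat.choose_eq_zero_of_lt (n.lt_succ_self.trans h)]

theorem cesaroOperator_cesaroEigenvector (ht0 : 0 ≤ t) (ht1 : t < 1) (m : ℕ) :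
    cesaroOperator p t (cesaroEigenvector p ht0 ht1 m) =
      (1 / ((m : ℂ) + 1)) • cesaroEigenvector p ht0 ht1 m := by
  have hm : (m : ℂ) + 1 ≠ 0 := by exact_mod_cast m.succ_ne_zero
  ext n
  rw [coeFn_smul_apply, one_div_mul_eq_div, eq_div_iff hm]
  induction n with
  | zero =>
    rw [cesaroOperator_apply_zero ht0 ht1, cesaroEigenvector_apply]
    rcases m with _ | m <;> simp
  | succ n ih =>
    have h2 : (n : ℂ) + 2 ≠ 0 := by exact_mod_cast (n + 1).succ_ne_zero
    have h3 := cesaroOperator_apply_succ ht0 ht1 (cesaroEigenvector p ht0 ht1 m) n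
    have h4 := cesaroEigenvector_succ (p := p) ht0 ht1 m n
    refine mul_left_cancel₀ h2 ?_
    linear_combination ((m : ℂ) + 1) * h3 + t * ((n : ℂ) + 1) * ih - h4

theorem pointSpectrum_cesaroOperator (ht0 : 0 ≤ t) (ht1 : t < 1) :
    pointSpectrum (cesaroOperator p t) = Set.range fun n : ℕ => 1 / ((n : ℂ) + 1) := by
  ext z
  rw [mem_pointSpectrum_iff]
  constructor
  · rintro ⟨x, hx0, hx⟩
    by_contra hz
    exact hx0 (eq_zero_of_cesaroOperator_apply_eq_smul ht0 ht1 hx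
      fun n hn => absurd ⟨n, hn.symm⟩ hz)
  · rintro ⟨m, rfl⟩
    exact ⟨_, cesaroEigenvector_ne_zero ht0 ht1 m, cesaroOperator_cesaroEigenvector ht0 ht1 m⟩

theorem mem_spectrum_cesaroOperator_iff (ht0 : 0 ≤ t) (ht1 : t < 1) {z : ℂ} (hz : z ≠ 0) :
    z ∈ spectrum ℂ (cesaroOperator p t) ↔ z ∈ Set.range fun n : ℕ => 1 / ((n : ℂ) + 1) := by
  rw [← pointSpectrum_cesaroOperator (p := p) ht0 ht1, ← hasEigenvalue_iff_mem_pointSpectrum]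
  exact (isCompactOperator_cesaroOperator.hasEigenvalue_iff_mem_spectrum hz).symm

theorem spectrum_cesaroOperator (ht0 : 0 ≤ t) (ht1 : t < 1) :
    spectrum ℂ (cesaroOperator p t) = (Set.range fun n : ℕ => 1 / ((n : ℂ) + 1)) ∪ {0} := by
  ext z
  rw [Set.mem_union, Set.mem_singleton_iff]
  by_cases hz : z = 0
  · subst hz
    refine iff_of_true ((spectrum.isClosed _).mem_of_tendsto tendsto_inv_natCast_add_one
      (Eventually.of_forall fun n => ?_)) (Or.inr rfl)
    have hn : ((n : ℂ) + 1)⁻¹ ≠ 0 := inv_ne_zero (by exact_mod_cast n.succ_ne_zero)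
    exact (mem_spectrum_cesaroOperator_iff ht0 ht1 hn).2 ⟨n, one_div _⟩
  · rw [mem_spectrum_cesaroOperator_iff ht0 ht1 hz]
    simp [hz]

/-- The spectral projection of the Cesàro operator at the eigenvalue `1`. -/
def cesaroProjection (p : ENNReal) [Fact (1 ≤ p)] (ht0 : 0 ≤ t) (ht1 : t < 1) :
    BachelisSpace p →L[ℂ] BachelisSpace p :=
  (coord 0).smulRight (cesaroEigenvector p ht0 ht1 0)

theorem cesaroProjection_apply (ht0 : 0 ≤ t) (ht1 : t < 1) (x : BachelisSpace p) :
    cesaroProjection p ht0 ht1 x = x 0 • cesaroEigenvector p ht0 ht1 0 := rfl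

theorem cesaroProjection_apply_zero (ht0 : 0 ≤ t) (ht1 : t < 1) (x : BachelisSpace p) :
    cesaroProjection p ht0 ht1 x 0 = x 0 := by
  rw [cesaroProjection_apply, coeFn_smul_apply, cesaroEigenvector_apply]
  simp

theorem isCompactOperator_cesaroProjection (ht0 : 0 ≤ t) (ht1 : t < 1) :
    IsCompactOperator (cesaroProjection p ht0 ht1) :=
  (isCompactOperator_of_locallyCompactSpace_dom (coord 0 : BachelisSpace p →L[ℂ] ℂ)).clm_comp
    ((ContinuousLinearMap.id ℂ ℂ).smulRight (cesaroEigenvector p ht0 ht1 0))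

theorem spectralRadius_cesaroOperator_sub_cesaroProjection_lt_one (ht0 : 0 ≤ t) (ht1 : t < 1) :
    spectralRadius ℂ (cesaroOperator p t - cesaroProjection p ht0 ht1) < 1 := by
  have hc : IsCompactOperator (cesaroOperator p t - cesaroProjection p ht0 ht1) :=
    isCompactOperator_cesaroOperator.sub (isCompactOperator_cesaroProjection ht0 ht1)
  refine lt_of_le_of_lt (b := ((1 / 2 : NNReal) : ENNReal)) (iSup₂_le fun z hz => ?_)
    (by exact_mod_cast NNReal.half_lt_self one_ne_zero)
  by_cases hz0 : z = 0
  · simp [hz0]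
  obtain ⟨x, hx0, hx⟩ := mem_pointSpectrum_iff.1 (hasEigenvalue_iff_mem_pointSpectrum.1
    ((hc.hasEigenvalue_iff_mem_spectrum hz0).2 hz))
  rw [sub_apply, sub_eq_iff_eq_add] at hx
  have h0 : x 0 = 0 := by
    have h := congrArg (coord 0) hx
    rw [coord_apply, coord_apply, cesaroOperator_apply_zero ht0 ht1, coeFn_add_apply,
      cesaroProjection_apply_zero, coeFn_smul_apply] at h
    simpa [hz0] using h
  rw [cesaroProjection_apply, h0, zero_smul, add_zero] at hx
  by_contra hlt
  refine hx0 (eq_zero_of_cesaroOperator_apply_eq_smul ht0 ht1 hx fun n hn => ?_)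
  rcases n with _ | n
  · exact h0
  · refine absurd ?_ hlt
    rw [ENNReal.coe_le_coe, ← NNReal.coe_le_coe, coe_nnnorm, hn, norm_div, norm_one,
      ← Nat.cast_succ, Complex.norm_natCast]
    push_cast
    gcongr
    linarith [n.cast_nonneg (α := ℝ)]

theorem tendsto_cesaroOperator_pow (ht0 : 0 ≤ t) (ht1 : t < 1) :
    Tendsto (fun n : ℕ => cesaroOperator p t ^ n) atTop (𝓝 (cesaroProjection p ht0 ht1)) := by
  refine tendsto_pow_of_spectralRadius_sub_lt_one ?_ ?_ ?_
    (spectralRadius_cesaroOperator_sub_cesaroProjection_lt_one ht0 ht1) <;>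
  refine ContinuousLinearMap.ext fun x => ?_
  · rw [mul_apply_eq_comp, cesaroProjection_apply, map_smul, cesaroOperator_cesaroEigenvector]
    simp
  · rw [mul_apply_eq_comp, cesaroProjection_apply, cesaroProjection_apply,
      cesaroOperator_apply_zero ht0 ht1]
  · rw [mul_apply_eq_comp, cesaroProjection_apply, cesaroProjection_apply_zero,
      cesaroProjection_apply]

theorem cesaroOperator_pow_apply_zero (ht0 : 0 ≤ t) (ht1 : t < 1) (n : ℕ)
    (x : BachelisSpace p) : (cesaroOperator p t ^ n) x 0 = x 0 := by
  induction n with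
  | zero => simp
  | succ n ih => rw [pow_succ', mul_apply_eq_comp, cesaroOperator_apply_zero ht0 ht1, ih]

theorem not_supercyclic_cesaroOperator (ht0 : 0 ≤ t) (ht1 : t < 1) :
    ¬ Supercyclic (cesaroOperator p t) := by
  rintro ⟨x, hx⟩
  obtain ⟨M, hM⟩ := powerBounded_of_tendsto (tendsto_cesaroOperator_pow (p := p) ht0 ht1)
  set K : ℝ := ‖(coord 1 : BachelisSpace p →L[ℂ] ℂ)‖ * (M * ‖x‖)
  have hbound : ∀ y ∈ {y : BachelisSpace p | ∃ (c : ℂ) (n : ℕ), y = c • (cesaroOperator p t ^ n) x},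
      y ∈ {y : BachelisSpace p | ‖coord 1 y‖ * ‖x 0‖ ≤ K * ‖coord 0 y‖} := by
    rintro _ ⟨c, n, rfl⟩
    have h1 : ‖coord 1 ((cesaroOperator p t ^ n) x)‖ ≤ K :=
      (ContinuousLinearMap.le_opNorm _ _).trans (mul_le_mul_of_nonneg_left
        (((cesaroOperator p t ^ n).le_opNorm x).trans
          (mul_le_mul_of_nonneg_right (hM n) (norm_nonneg _))) (norm_nonneg _))
    rw [Set.mem_ofPred_eq, map_smul, map_smul, smul_eq_mul, smul_eq_mul, norm_mul, norm_mul,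
      coord_apply 0, cesaroOperator_pow_apply_zero ht0 ht1]
    calc ‖c‖ * ‖coord 1 ((cesaroOperator p t ^ n) x)‖ * ‖x 0‖ ≤ ‖c‖ * K * ‖x 0‖ := by gcongr
      _ = K * (‖c‖ * ‖x 0‖) := by ring
  have hclosed : IsClosed {y : BachelisSpace p | ‖coord 1 y‖ * ‖x 0‖ ≤ K * ‖coord 0 y‖} :=
    isClosed_le (by fun_prop) (by fun_prop)
  have hx0 : x 0 = 0 := by
    have h := hclosed.closure_subset_iff.2 hbound (hx (single 1))
    simpa [single_apply] using h
  have hzero : IsClosed {y : BachelisSpace p | coord 0 y = 0} :=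
    isClosed_eq (by fun_prop) continuous_const
  have h := hzero.closure_subset_iff.2 (fun y hy => ?_) (hx (single 0))
  · simp [single_apply] at h
  · obtain ⟨c, n, rfl⟩ := hy
    rw [Set.mem_ofPred_eq, map_smul, coord_apply, cesaroOperator_pow_apply_zero ht0 ht1, hx0,
      smul_zero]

end

end Bachelis

end

theorem propositionP7p2 (p : ENNReal) [Fact (1 ≤ p)] (hp : 1 < p) (hp' : p < ⊤)
    (t : ℝ) (ht0 : 0 ≤ t) (ht1 : t < 1) :
    ∃ C : Bachelis.BachelisSpace p →L[ℂ] Bachelis.BachelisSpace p,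
      (∀ (x : Bachelis.BachelisSpace p) (n : ℕ), C x n = Bachelis.cesaro t x n) ∧
      ‖C‖ ≤ 1 / (1 - t) ∧
      IsCompactOperator C ∧
      Bachelis.pointSpectrum C = Set.range (fun n : ℕ => 1 / ((n : ℂ) + 1)) ∧
      spectrum ℂ C = Set.range (fun n : ℕ => 1 / ((n : ℂ) + 1)) ∪ {0} ∧
      Bachelis.PowerBounded C ∧
      Bachelis.UniformlyMeanErgodic C ∧
      ¬ Bachelis.Supercyclic C :=
  have h := Bachelis.tendsto_cesaroOperator_pow (p := p) ht0 ht1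
  ⟨Bachelis.cesaroOperator p t, Bachelis.cesaroOperator_apply ht0 ht1,
    Bachelis.norm_cesaroOperator_le ht0 ht1, Bachelis.isCompactOperator_cesaroOperator,
    Bachelis.pointSpectrum_cesaroOperator ht0 ht1, Bachelis.spectrum_cesaroOperator ht0 ht1,
    Bachelis.powerBounded_of_tendsto h, Bachelis.uniformlyMeanErgodic_of_tendsto h,
    Bachelis.not_supercyclic_cesaroOperator ht0 ht1⟩
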